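/- Let $\nu=\sum_{p=1}^P w_p\,\mathcal N(m_p,\Sigma_p)$ be a finite mixture of Gaussian distributions on $\mathbb R^N$ (weights $w_p\ge 0$ with $\sum_p w_p=1$, means $m_p\in\mathbb R^N$, positive semidefinite covariance matrices $\Sigma_p$). **Setting.** Let $1\le k<Q$ and let $x_0,x_1,\dots,x_Q$ be independent random points with law $\nu$. Here $x_0$ is the query, and the other points are relabelled so that $d(x_0,x_1)\le d(x_0,x_2)\le\dots\le d(x_0,x_Q)$, where $d$ is the Euclidean distance (ties are broken by the original label). The *$k$-order gap* is $\Delta_k=d(x_0,x_{k+1})-d(x_0,x_k)$. A constant $c>0$ is called *admissible* for $\Delta_k$ if $$\mathbb P\bigl(\Delta_k-\mathbb E[\Delta_k]<-t\bigr)\le e^{-ct^2}\qquad\text{for all } t>0 .$$ A *binary hashing* is a function $f:\mathbb R^N\to\{0,1\}^M$, which may depend on the data and on further randomness in an arbitrary way (the codes $f(x_i)$ being measurable). Its *worst-case distortion* on the data is $$\delta=\inf_{\lambda>0}\ \sup_{0\le j<i\le Q}\bigl|\lambda\, d_H(f(x_i),f(x_j))-d(x_i,x_j)\bigr| ,$$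 with $d_H$ the Hamming distance. The hashing *preserves the $k$ nearest neighbours* of $x_0$ if $d_H(f(x_0),f(x_i))\le d_H(f(x_0),f(x_j))$ for all $1\le i\le k<j\le Q$. **Theorem.** The gap $\Delta_k$ is integrable, and there is a constant $c_0>0$, depending only on the mixture (not on $Q$, $k$, the hashing or $\varepsilon$), that is admissible for every $\Delta_k$ with $1\le k<Q$. Moreover, for every $1\le k<Q$, every $c>0$ that is admissible for $\Delta_k$ (in particular $c=c_0$), every $M$, every binary hashing and every $\varepsilon>0$, with probability at least $1-\varepsilon$ the following implication holds: if $$\mathbb E[\Delta_k]\ \ge\ 2\delta+\sqrt{\tfrac1c\log\tfrac{Qk}{\varepsilon}} ,$$ then the hashing preserves the $k$ nearest neighbours of $x_0$. In particular, if this inequality holds almost surely, then the hashing preserves the $k$ nearest neighbours of $x_0$ with probability at least $1-\varepsilon$. (For $\varepsilon>Qk$ the square root is read as $0$.) -/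

import Mathlib

open MeasureTheory ProbabilityTheory

universe u

noncomputable section

namespace BinaryHashing

/-- Euclidean space `ℝ^N`, with the Euclidean distance. -/
abbrev Point (N : ℕ) := EuclideanSpace ℝ (Fin N)

/-- Binary codes of length `M`; they are compared by the Hamming distance `hammingDist`. -/
abbrev Code (M : ℕ) := Fin M → Bool

/-- The finite Gaussian mixture `∑ p, w p • N(m p, S p)` on `ℝ^N`. -/
def gaussianMixture {N P : ℕ} (w : Fin P → NNReal) (m : Fin P → Point N)
    (S : Fin P → Matrix (Fin N) (Fin N) ℝ) : Measure (Point N) :=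
  ∑ p, (w p) • multivariateGaussian (m p) (S p)

/-- A data set consists of the query `x 0` and `Q` further points `x 1, …, x Q`. This is the same
data set with the further points relabelled by increasing distance from the query:
`ordered x 0 = x 0`, and `ordered x j` is the `j`-th nearest neighbour of the query, for
`j = 1, …, Q` (ties are broken by the original label). -/
def ordered {N Q : ℕ} (x : Fin (Q + 1) → Point N) : Fin (Q + 1) → Point N :=
  Fin.cases (x 0) fun j => x (Tuple.sort (fun i : Fin Q => dist (x 0) (x i.succ)) j).succ

/-- The `k`-order gap `Δ_k = d(x₀, x_{k+1}) - d(x₀, x_k)`, where `x_j` is the `j`-th nearest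
neighbour of the query `x₀`. Here `k < Q`, so that `k.castSucc` and `k.succ` are the labels `k` and
`k + 1` among `0, …, Q`. -/
def orderGap {N Q : ℕ} (k : Fin Q) (x : Fin (Q + 1) → Point N) : ℝ :=
  dist (ordered x 0) (ordered x k.succ) - dist (ordered x 0) (ordered x k.castSucc)

/-- The worst-case distortion
`δ = inf_{lam > 0} sup_{i > j} |lam * d_H(f (x i), f (x j)) - d(x i, x j)|`
of a hash function `f` on the data set `x 0, …, x Q`. -/
def distortion {N Q M : ℕ} (f : Point N → Code M) (x : Fin (Q + 1) → Point N) : ℝ :=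
  ⨅ lam : Set.Ioi (0 : ℝ), ⨆ ij : {ij : Fin (Q + 1) × Fin (Q + 1) // ij.2 < ij.1},
    |(lam : ℝ) * (hammingDist (f (x ij.1.1)) (f (x ij.1.2)) : ℝ) - dist (x ij.1.1) (x ij.1.2)|

/-- The hash function `f` preserves the `k` nearest neighbours of the query: in Hamming distance
from the code of the query, none of the `k` nearest neighbours is farther than one of the other
`Q - k` points. -/
def PreservesNeighbors {N Q M : ℕ} (k : Fin Q) (f : Point N → Code M)
    (x : Fin (Q + 1) → Point N) : Prop :=
  ∀ i j : Fin (Q + 1), 1 ≤ (i : ℕ) → (i : ℕ) ≤ (k : ℕ) → (k : ℕ) < (j : ℕ) →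
    hammingDist (f (ordered x 0)) (f (ordered x i)) ≤
      hammingDist (f (ordered x 0)) (f (ordered x j))

/-- `c` is a constant in a sub-Gaussian lower-tail bound for the random variable `X`:
`P(X - E[X] < -t) ≤ exp (-c t²)` for all `t > 0`. -/
def SubGaussianLowerTail {Ω : Type*} [MeasurableSpace Ω] (X : Ω → ℝ) (μ : Measure Ω)
    (c : ℝ) : Prop :=
  ∀ t : ℝ, 0 < t → μ.real {ω | X ω - ∫ ω', X ω' ∂μ < -t} ≤ Real.exp (-c * t ^ 2)

end BinaryHashing

end

noncomputable section

namespace BinaryHashing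

/-! Since the gap is nonnegative, a sub-Gaussian lower tail needs only a bound on its second moment
(`SubGaussianLowerTail.of_second_moment`), so a bound uniform in `Q` and `k` suffices.

Such a bound comes from a relative tail estimate: for a Gaussian, P(d > a + margin) is at most h ·
P(d > a), with h a Gaussian tail that does not depend on a. It is proved by contracting the
underlying standard Gaussian vector, so singular covariances cause no trouble. A gap larger than the
margin separates the set `T` of far labels from the others. Resampling one point of `T` bounds this
event by h times the event of plain separation (`pi_upperEvent_le`). Plain separations are disjoint
for distinct `T` of equal size, so the sum over `T` is at most h, with no combinatorial factor.

The hashing part is deterministic: a reversed pair of neighbours forces the gap to be at most twice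
the distortion. Failure under the hypothesis thus puts the gap in its lower tail, whatever `f`
depends on. -/

/-! ### Scaling of the standard Gaussian measure -/

theorem lintegral_pi_prod (g : ℝ → ENNReal) (hg : Measurable g) (n : ℕ) :
    ∀ s : Fin n → Set ℝ, (∀ i, MeasurableSet (s i)) →
      ∫⁻ x : Fin n → ℝ, ∏ i, (s i).indicator g (x i) = ∏ i, ∫⁻ t in s i, g t := by
  induction n with
  | zero => intro s _; simp [lintegral_unique, volume_pi]
  | succ n ih =>
    intro s hs
    have hm : ∀ i, Measurable ((s i).indicator g) := fun i => hg.indicator (hs i)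
    have e := (volume_preserving_piFinSuccAbove (fun _ : Fin (n + 1) => ℝ) 0).symm
    rw [← e.lintegral_comp (by fun_prop), Fin.prod_univ_succ, ← ih _ fun i => hs i.succ,
      ← lintegral_indicator (hs 0), Measure.volume_eq_prod,
      ← lintegral_prod_mul (hm 0).aemeasurable
        (Finset.measurable_prod _ fun i _ => (hm i.succ).comp (measurable_pi_apply i)).aemeasurable]
    refine lintegral_congr fun z => ?_
    simp [Fin.prod_univ_succ, MeasurableEquiv.piFinSuccAbove]

/-- The Lebesgue density of the standard Gaussian measure on `ℝⁿ`. -/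
def stdDensity {n : ℕ} (x : Fin n → ℝ) : ENNReal := ∏ i, gaussianPDF 0 1 (x i)

theorem measurable_stdDensity {n : ℕ} : Measurable (stdDensity (n := n)) := by
  unfold stdDensity; fun_prop

theorem pi_gaussianReal_eq_withDensity (n : ℕ) :
    Measure.pi (fun _ : Fin n => gaussianReal 0 1) = volume.withDensity stdDensity := by
  refine Measure.pi_eq fun s hs => ?_
  rw [withDensity_apply _ (.univ_pi hs), ← lintegral_indicator (.univ_pi hs)]
  simp_rw [gaussianReal_apply 0 one_ne_zero]
  rw [← lintegral_pi_prod _ (measurable_gaussianPDF 0 1) n s hs]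
  refine lintegral_congr fun x => ?_
  by_cases hx : x ∈ Set.univ.pi s
  · rw [Set.indicator_of_mem hx]
    exact Finset.prod_congr rfl fun i _ => (Set.indicator_of_mem (hx i trivial) _).symm
  · rw [Set.indicator_of_notMem hx]
    obtain ⟨i, hi⟩ : ∃ i, x i ∉ s i := by simpa using hx
    exact (Finset.prod_eq_zero (Finset.mem_univ i) (Set.indicator_of_notMem hi _)).symm

theorem stdDensity_eq_smul {n : ℕ} (θ : ℝ) (x : Fin n → ℝ) :
    stdDensity x =
      ENNReal.ofReal (Real.exp (-((1 - θ ^ 2) * ∑ i, x i ^ 2 / 2))) * stdDensity (θ • x) := by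
  simp only [stdDensity, gaussianPDF]
  rw [← ENNReal.ofReal_prod_of_nonneg fun _ _ => gaussianPDFReal_nonneg _ _ _,
    ← ENNReal.ofReal_prod_of_nonneg fun _ _ => gaussianPDFReal_nonneg _ _ _,
    ← ENNReal.ofReal_mul (Real.exp_nonneg _), Finset.mul_sum, ← Finset.sum_neg_distrib,
    Real.exp_sum, ← Finset.prod_mul_distrib]
  congr 1
  refine Finset.prod_congr rfl fun i _ => ?_
  simp only [gaussianPDFReal, Pi.smul_apply, smul_eq_mul]
  rw [mul_left_comm, ← Real.exp_add]
  congr 2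
  simp
  ring

/-- Shrinking a set by the factor `θ` changes its standard Gaussian measure in a controlled way. -/
theorem stdGaussian_le_of_smul_mem {n : ℕ} {B B' : Set (Point n)} (hB : MeasurableSet B)
    (hB' : MeasurableSet B') {θ τ : ℝ} (hθ : 0 < θ) (hmem : ∀ z ∈ B, θ • z ∈ B')
    (hτ : ∀ z ∈ B, τ ≤ (1 - θ ^ 2) * (‖z‖ ^ 2 / 2)) :
    stdGaussian (Point n) B ≤
      ENNReal.ofReal (Real.exp (-τ) * (θ ^ n)⁻¹) * stdGaussian (Point n) B' := by
  have hL : Measurable (WithLp.toLp 2 : (Fin n → ℝ) → Point n) := by fun_prop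
  rw [← map_pi_eq_stdGaussian, Measure.map_apply hL hB, Measure.map_apply hL hB',
    pi_gaussianReal_eq_withDensity, withDensity_apply _ (hL hB), withDensity_apply _ (hL hB'),
    ← lintegral_indicator (hL hB), ← lintegral_indicator (hL hB')]
  set F := (WithLp.toLp 2 ⁻¹' B' : Set (Fin n → ℝ)).indicator stdDensity
  have hF : Measurable F := measurable_stdDensity.indicator (hL hB')
  calc _ ≤ ∫⁻ x, ENNReal.ofReal (Real.exp (-τ)) * F (θ • x) := by
        refine lintegral_mono fun x => ?_
        by_cases hx : WithLp.toLp 2 x ∈ B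
        · rw [Set.indicator_of_mem (by exact hx)]
          have h1 : F (θ • x) = stdDensity (θ • x) :=
            Set.indicator_of_mem (by simpa using hmem _ hx) _
          rw [h1, stdDensity_eq_smul θ x]
          gcongr
          have := hτ _ hx
          rw [EuclideanSpace.real_norm_sq_eq] at this
          simpa [Finset.sum_div] using this
        · rw [Set.indicator_of_notMem (by exact hx)]; exact zero_le
    _ = ENNReal.ofReal (Real.exp (-τ)) * ∫⁻ x, F x ∂(Measure.map (θ • ·) volume) := by
        rw [lintegral_const_mul _ (by fun_prop), lintegral_map hF (by fun_prop)]
    _ = _ := by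
        rw [Measure.map_addHaar_smul _ hθ.ne', lintegral_smul_measure, smul_eq_mul, ← mul_assoc,
          ← ENNReal.ofReal_mul (Real.exp_nonneg _), Module.finrank_fin_fun,
          abs_of_nonneg (by positivity)]

/-! ### Relative tails of Gaussian distances -/

open scoped MatrixOrder in
/-- The tail of a Gaussian vector's distance to a point decays uniformly, beyond a threshold that
is affine in the norm of the point. -/
theorem multivariateGaussian_tail {N : ℕ} (m : Point N) (S : Matrix (Fin N) (Fin N) ℝ) {K L : ℝ}
    (hK : ‖m‖ ≤ K) (hL0 : 0 < L) (hL : ‖Matrix.toEuclideanCLM (𝕜 := ℝ) (CFC.sqrt S)‖ ≤ L)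
    (y : Point N) {a s : ℝ} (ha : 0 ≤ a) (hs : 0 < s) :
    multivariateGaussian m S {x | a + (s + 4 * (‖y‖ + K)) < dist y x} ≤
      ENNReal.ofReal (2 ^ N * Real.exp (-(1 / (8 * L ^ 2)) * s ^ 2)) *
        multivariateGaussian m S {x | a < dist y x} := by
  set A := Matrix.toEuclideanCLM (𝕜 := ℝ) (CFC.sqrt S)
  have hK0 : 0 ≤ K := (norm_nonneg _).trans hK
  have hmeas : ∀ b : ℝ, MeasurableSet {x : Point N | b < dist y x} := fun b =>
    measurableSet_lt (by fun_prop) (by fun_prop)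
  have hmap : Measurable fun z : Point N => m + A z := by fun_prop
  simp only [multivariateGaussian]
  rw [Measure.map_apply hmap (hmeas _), Measure.map_apply hmap (hmeas _)]
  set T := s + 4 * (‖y‖ + K) with hT
  have hsT : s ≤ T := by rw [hT]; linarith [norm_nonneg y]
  have hT0 : 0 < T := hs.trans_le hsT
  set v := m - y
  have hv : ‖v‖ ≤ T / 4 := (norm_sub_le _ _).trans (by rw [hT]; linarith)
  have hd : ∀ z, dist y (m + z) = ‖v + z‖ := fun z => by
    rw [dist_comm, dist_eq_norm, add_sub_right_comm]
  -- Contraction by `θ` takes radius `a + T` to `a + T / 2`; the offset `v` costs at most `2 * ‖v‖ ≤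
  -- T / 2` more, so the image stays beyond `a`. Also `θ ≥ 1 / 2`, which bounds the Jacobian factor
  -- by `2 ^ N`.
  set θ := (a + T / 2) / (a + T) with hθ
  have haT : 0 < a + T := by linarith
  have hθ0 : 0 < θ := by positivity
  have hθ2 : 1 / 2 ≤ θ := by rw [hθ, div_le_div_iff₀ (by norm_num) haT]; linarith
  have hθ1 : θ ≤ 1 := by rw [hθ, div_le_one haT]; linarith
  have hθm : θ * (a + T) = a + T / 2 := by rw [hθ]; field_simp
  have hAz : ∀ z, a + T < ‖v + A z‖ → a + T * (3 / 4) < ‖A z‖ := fun z hz => by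
    linarith [norm_add_le v (A z)]
  refine (stdGaussian_le_of_smul_mem (hmap (hmeas _)) (hmap (hmeas a)) hθ0
    (τ := 1 / (8 * L ^ 2) * s ^ 2)
    ?_ ?_).trans ?_
  · intro z hz
    simp only [Set.mem_preimage, Set.mem_ofPred_eq, hd] at hz ⊢
    rw [map_smul]
    have h1 : θ * (a + T) < θ * ‖v + A z‖ := by gcongr
    have h2 : θ * ‖v + A z‖ ≤ θ * ‖v‖ + θ * ‖A z‖ := by
      rw [← mul_add]; gcongr; exact norm_add_le _ _
    have h3 : ‖θ • A z‖ = θ * ‖A z‖ := by rw [norm_smul, Real.norm_of_nonneg hθ0.le]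
    have h4 : ‖θ • A z‖ ≤ ‖v + θ • A z‖ + ‖v‖ := by
      simpa using norm_sub_le (v + θ • A z) v
    have h5 : θ * ‖v‖ ≤ ‖v‖ := mul_le_of_le_one_left (norm_nonneg _) hθ1
    linarith
  · intro z hz
    simp only [Set.mem_preimage, Set.mem_ofPred_eq, hd] at hz
    have h1 : (a + T) * (3 / 4) ≤ L * ‖z‖ := by
      have := (A.le_opNorm z).trans (mul_le_mul_of_nonneg_right hL (norm_nonneg z))
      linarith [hAz z hz]
    have h2 : ((a + T) * (3 / 4)) ^ 2 ≤ L ^ 2 * ‖z‖ ^ 2 := by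
      rw [← mul_pow]; gcongr
    -- `1 - θ ^ 2` is at least `T / (2 * (a + T))`, while `‖z‖ ^ 2` is of order `(a + T) ^ 2`: the
    -- product is at least of order `T * (a + T) ≥ s ^ 2`, uniformly in `a`.
    have h3 : T / 2 ≤ (1 - θ ^ 2) * (a + T) := by nlinarith
    have h4 : s ^ 2 ≤ T * (a + T) := by nlinarith
    have h5 : (T / 2) * ((a + T) * (9 / 16)) ≤ (1 - θ ^ 2) * (L ^ 2 * ‖z‖ ^ 2) := by
      calc (T / 2) * ((a + T) * (9 / 16)) ≤ (1 - θ ^ 2) * (a + T) * ((a + T) * (9 / 16)) := by gcongr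
        _ = (1 - θ ^ 2) * ((a + T) * (3 / 4)) ^ 2 := by ring
        _ ≤ _ := by
          gcongr
          nlinarith
    rw [div_mul_eq_mul_div, one_mul, div_le_iff₀ (by positivity)]
    nlinarith [mul_nonneg hT0.le haT.le]
  · gcongr ?_ * _
    refine ENNReal.ofReal_le_ofReal ?_
    rw [mul_comm, neg_mul, ← inv_pow]
    gcongr
    rw [inv_le_comm₀ hθ0 two_pos]
    linarith

-- The estimate is linear in the measure, so it passes to mixtures once `K` and `L` serve all
-- components. The summand 1 in `L` keeps it positive when all covariances vanish.
open scoped MatrixOrder in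
theorem gaussianMixture_tail {N P : ℕ} (w : Fin P → NNReal) (m : Fin P → Point N)
    (S : Fin P → Matrix (Fin N) (Fin N) ℝ) :
    ∃ K L : ℝ, 0 < L ∧ 0 ≤ K ∧ ∀ (y : Point N) (a s : ℝ), 0 ≤ a → 0 < s →
      gaussianMixture w m S {x | a + (s + 4 * (‖y‖ + K)) < dist y x} ≤
        ENNReal.ofReal (2 ^ N * Real.exp (-L * s ^ 2)) *
          gaussianMixture w m S {x | a < dist y x} := by
  set A := fun p => Matrix.toEuclideanCLM (𝕜 := ℝ) (CFC.sqrt (S p))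
  set L := 1 + ∑ p, ‖A p‖
  have hL : 0 < L := by positivity
  refine ⟨∑ p, ‖m p‖, 1 / (8 * L ^ 2), by positivity, by positivity, fun y a s ha hs => ?_⟩
  simp only [gaussianMixture, Measure.coe_finsetSum, Finset.sum_apply, Finset.mul_sum,
    Measure.smul_apply]
  refine Finset.sum_le_sum fun p _ => ?_
  rw [mul_smul_comm]
  gcongr
  refine multivariateGaussian_tail _ _ ?_ hL ?_ y ha hs
  · exact Finset.single_le_sum (f := fun p => ‖m p‖) (fun _ _ => norm_nonneg _) (Finset.mem_univ p)
  · exact (Finset.single_le_sum (f := fun p => ‖A p‖) (fun _ _ => norm_nonneg _)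
      (Finset.mem_univ p)).trans (by simp [L])

/-! ### Measurability and sign of the gap -/

/-- All sorting permutations give the same sorted values, so tie-breaking is irrelevant and the
preimage is a finite union over permutations. -/
theorem measurable_apply_sort {n : ℕ} (j : Fin n) :
    Measurable fun R : Fin n → ℝ => R (Tuple.sort R j) := by
  refine measurable_of_Iio fun a => ?_
  have : (fun R : Fin n → ℝ => R (Tuple.sort R j)) ⁻¹' Set.Iio a =
      ⋃ σ : Equiv.Perm (Fin n), (⋂ p : Fin n × Fin n, ⋂ _ : p.1 ≤ p.2, {R | R (σ p.1) ≤ R (σ p.2)}) ∩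
        {R | R (σ j) < a} := by
    ext R
    simp only [Set.mem_preimage, Set.mem_Iio, Set.mem_iUnion, Set.mem_inter_iff, Set.mem_iInter,
      Set.mem_ofPred_eq, Prod.forall]
    refine ⟨fun h => ⟨Tuple.sort R, fun a b hab => Tuple.monotone_sort R hab, h⟩, ?_⟩
    rintro ⟨σ, hσ, h⟩
    have := congrFun (Tuple.unique_monotone (f := R) (σ := σ) (τ := Tuple.sort R)
      (fun a b hab => hσ a b hab) (Tuple.monotone_sort R)) j
    simp only [Function.comp_apply] at this
    rwa [← this]
  rw [this]
  refine .iUnion fun σ => .inter (.iInter fun p => .iInter fun _ => ?_) ?_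
  · exact measurableSet_le (measurable_pi_apply _) (measurable_pi_apply _)
  · exact measurableSet_lt (measurable_pi_apply _) measurable_const

/-- Sort positions start at 0 and neighbour labels at 1, hence the shift: position `k.castSucc`
holds the neighbour with label `k + 1`. -/
theorem orderGap_succ {N n : ℕ} (k : Fin n) (x : Fin (n + 2) → Point N) :
    orderGap k.succ x =
      dist (x 0) (x (Tuple.sort (fun i : Fin (n + 1) => dist (x 0) (x i.succ)) k.succ).succ) -
      dist (x 0) (x (Tuple.sort (fun i : Fin (n + 1) => dist (x 0) (x i.succ)) k.castSucc).succ) :=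
  rfl

theorem measurable_orderGap {N n : ℕ} (k : Fin n) :
    Measurable fun x : Fin (n + 2) → Point N => orderGap k.succ x := by
  have hR : Measurable fun (x : Fin (n + 2) → Point N) (i : Fin (n + 1)) =>
      dist (x 0) (x i.succ) := by fun_prop
  exact ((measurable_apply_sort k.succ).comp hR).sub ((measurable_apply_sort k.castSucc).comp hR)

theorem orderGap_nonneg {N n : ℕ} (k : Fin n) (x : Fin (n + 2) → Point N) :
    0 ≤ orderGap k.succ x := by
  rw [orderGap_succ, sub_nonneg]
  exact Tuple.monotone_sort (fun i : Fin (n + 1) => dist (x 0) (x i.succ))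
    (Fin.castSucc_lt_succ (i := k)).le

/-! ### Separation events and the tail of the gap -/

/-- The data sets in which the points with labels in `T` are farther from the query than all
others, by more than the margin `b (x 0)`. -/
def upperEvent {N n : ℕ} (T : Finset (Fin n)) (b : Point N → ℝ) : Set (Fin (n + 1) → Point N) :=
  ⋂ l, ⋂ j, ⋂ _ : l ∉ T ∧ j ∈ T,
    {x | dist (x 0) (x l.succ) + b (x 0) < dist (x 0) (x j.succ)}

theorem mem_upperEvent {N n : ℕ} {T : Finset (Fin n)} {b : Point N → ℝ}
    {x : Fin (n + 1) → Point N} : x ∈ upperEvent T b ↔ ∀ l j, l ∉ T → j ∈ T →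
      dist (x 0) (x l.succ) + b (x 0) < dist (x 0) (x j.succ) := by
  simp only [upperEvent, Set.mem_iInter, Set.mem_ofPred_eq, and_imp]

theorem measurableSet_upperEvent {N n : ℕ} (T : Finset (Fin n)) {b : Point N → ℝ}
    (hb : Measurable b) : MeasurableSet (upperEvent T b) :=
  .iInter fun _ => .iInter fun _ => .iInter fun _ => measurableSet_lt (by fun_prop) (by fun_prop)

/-- A bound on the relative tail of the distance law passes to the event that a given set of
labels is separated from the others. -/
theorem pi_upperEvent_le {N n : ℕ} (ν : Measure (Point N)) [IsProbabilityMeasure ν]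
    {b : Point N → ℝ} (hb : Measurable b) (hb0 : ∀ y, 0 ≤ b y) {h : ENNReal}
    (H : ∀ y a, 0 ≤ a → ν {x | a + b y < dist y x} ≤ h * ν {x | a < dist y x})
    {T : Finset (Fin n)} (hT : T.Nonempty) (hT' : (Tᶜ).Nonempty) :
    Measure.pi (fun _ : Fin (n + 1) => ν) (upperEvent T b) ≤
      h * Measure.pi (fun _ : Fin (n + 1) => ν) (upperEvent T fun _ => 0) := by
  obtain ⟨j₀, hj₀⟩ := hT
  have hG := measurableSet_upperEvent T hb
  have hU := measurableSet_upperEvent (N := N) T (b := fun _ => 0) measurable_const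
  rw [← lintegral_indicator_one hG, ← lintegral_indicator_one hU,
    ← lintegral_const_mul _ (measurable_one.indicator hU)]
  -- Only the point labelled `j₀` is integrated out; the query and all other points are frozen.
  -- Among the labels outside `T`, the point has to beat only the farthest one, `l₀`.
  refine lintegral_le_of_lmarginal_le {j₀.succ} (measurable_one.indicator hG)
    ((measurable_one.indicator hU).const_mul _) ?_
  rw [lmarginal_singleton, lmarginal_singleton]
  intro x
  have h0 : ∀ y, Function.update x j₀.succ y 0 = x 0 := fun y =>
    Function.update_of_ne (Fin.succ_ne_zero j₀).symm _ _
  have hs : ∀ y, ∀ i ≠ j₀, Function.update x j₀.succ y i.succ = x i.succ := fun y i hi =>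
    Function.update_of_ne (fun e => hi (Fin.succ_injective _ e)) _ _
  obtain ⟨l₀, hl₀, hmax⟩ := Finset.exists_max_image Tᶜ (fun l => dist (x 0) (x l.succ)) hT'
  simp only [Finset.mem_compl] at hl₀ hmax
  have hne : ∀ {l}, l ∉ T → l ≠ j₀ := fun hl e => hl (e ▸ hj₀)
  have hu : Measurable (Function.update x j₀.succ) := measurable_update x
  have key : ∀ A : Set (Fin (n + 1) → Point N), MeasurableSet A →
      ∫⁻ y, A.indicator (1 : (Fin (n + 1) → Point N) → ENNReal) (Function.update x j₀.succ y) ∂ν =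
        ν (Function.update x j₀.succ ⁻¹' A) :=
    fun A hA => lintegral_indicator_one (hu hA)
  have hc : ∫⁻ y, h * (upperEvent T fun _ => 0).indicator (1 : (Fin (n + 1) → Point N) → ENNReal)
      (Function.update x j₀.succ y) ∂ν =
        h * ν (Function.update x j₀.succ ⁻¹' (upperEvent T fun _ => 0)) :=
    (lintegral_const_mul h ((measurable_one.indicator hU).comp hu)).trans
      (congrArg (h * ·) (key _ hU))
  simp only [key _ hG, hc]
  by_cases hP : ∀ l j, l ∉ T → j ∈ T → j ≠ j₀ → dist (x 0) (x l.succ) < dist (x 0) (x j.succ)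
  · calc _ ≤ ν {y | dist (x 0) (x l₀.succ) + b (x 0) < dist (x 0) y} := by
          refine measure_mono fun y hy => ?_
          have := mem_upperEvent.1 (Set.mem_preimage.1 hy) l₀ j₀ hl₀ hj₀
          rwa [h0, hs _ _ (hne hl₀), Function.update_self] at this
      _ ≤ h * ν {y | dist (x 0) (x l₀.succ) < dist (x 0) y} := H _ _ dist_nonneg
      _ ≤ _ := by
          refine mul_le_mul_right (measure_mono fun y hy => ?_) _
          refine Set.mem_preimage.2 (mem_upperEvent.2 fun l j hl hj => ?_)
          rw [h0, hs _ _ (hne hl), add_zero]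
          by_cases hjj : j = j₀
          · rw [hjj, Function.update_self]
            exact (hmax l hl).trans_lt hy
          · rw [hs _ _ hjj]
            exact hP l j hl hj hjj
  -- The frozen points already violate the separation, so the left fibre is empty.
  · have : Function.update x j₀.succ ⁻¹' upperEvent T b = ∅ := by
      refine Set.eq_empty_of_forall_notMem fun y hy => hP fun l j hl hj hjj => ?_
      have := mem_upperEvent.1 (Set.mem_preimage.1 hy) l j hl hj
      rw [h0, hs _ _ (hne hl), hs _ _ hjj] at this
      linarith [hb0 (x 0)]
    rw [this, measure_empty]
    exact zero_le

/-- A bound on the relative tail of the distance law is a tail bound for every order gap. -/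
theorem pi_lt_orderGap_le {N n : ℕ} (ν : Measure (Point N)) [IsProbabilityMeasure ν]
    {b : Point N → ℝ} (hb : Measurable b) (hb0 : ∀ y, 0 ≤ b y) {h : ENNReal}
    (H : ∀ y a, 0 ≤ a → ν {x | a + b y < dist y x} ≤ h * ν {x | a < dist y x}) (k : Fin n) :
    Measure.pi (fun _ : Fin (n + 2) => ν) {x | b (x 0) < orderGap k.succ x} ≤ h := by
  classical
  set F : Finset (Finset (Fin (n + 1))) := (Finset.univ : Finset (Equiv.Perm (Fin (n + 1)))).image
    fun σ : Equiv.Perm (Fin (n + 1)) => (Finset.Ioi k.castSucc).image σ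
  have hcard : ∀ T ∈ F, T.card = (Finset.Ioi k.castSucc).card := by
    intro T hT
    obtain ⟨σ, -, rfl⟩ := Finset.mem_image.1 hT
    exact Finset.card_image_of_injective _ σ.injective
  have hne : ∀ T ∈ F, T.Nonempty ∧ (Tᶜ).Nonempty := by
    intro T hT
    obtain ⟨σ, -, rfl⟩ := Finset.mem_image.1 hT
    refine ⟨⟨σ k.succ, Finset.mem_image_of_mem _ ?_⟩, ⟨σ k.castSucc, ?_⟩⟩
    · exact Finset.mem_Ioi.2 Fin.castSucc_lt_succ
    · simp only [Finset.mem_compl, Finset.mem_image, EmbeddingLike.apply_eq_iff_eq]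
      rintro ⟨i, hi, rfl⟩
      exact (Finset.mem_Ioi.1 hi).false
  have hsub : {x : Fin (n + 2) → Point N | b (x 0) < orderGap k.succ x} ⊆
      ⋃ T ∈ F, upperEvent T b := by
    intro x hx
    simp only [Set.mem_ofPred_eq, orderGap_succ] at hx
    set R := fun i : Fin (n + 1) => dist (x 0) (x i.succ) with hR
    set σ := Tuple.sort R with hσ
    have hmono := Tuple.monotone_sort R
    refine Set.mem_iUnion₂.2 ⟨_, Finset.mem_image_of_mem _ (Finset.mem_univ σ),
      mem_upperEvent.2 fun l j hl hj => ?_⟩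
    obtain ⟨i, hi, rfl⟩ := Finset.mem_image.1 hj
    obtain ⟨i', rfl⟩ := σ.surjective l
    have hi' : i' ≤ k.castSucc := by
      by_contra hc
      exact hl (Finset.mem_image_of_mem _ (Finset.mem_Ioi.2 (not_le.1 hc)))
    have h1 : R (σ i') ≤ R (σ k.castSucc) := hmono hi'
    have h2 : R (σ k.succ) ≤ R (σ i) := hmono (Fin.castSucc_lt_iff_succ_le.1 (Finset.mem_Ioi.1 hi))
    simp only [hR] at h1 h2
    linarith
  have hdisj : Set.PairwiseDisjoint (F : Set (Finset (Fin (n + 1))))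
      fun T => upperEvent (N := N) T fun _ => 0 := by
    intro T hT T' hT' hTT'
    refine Set.disjoint_left.2 fun x hx hx' => ?_
    have hc := (hcard T hT).trans (hcard T' hT').symm
    -- Equal cardinality gives each set a label that the other lacks; the two separations order this
    -- pair in opposite ways.
    obtain ⟨j, hj, hj'⟩ := Finset.not_subset.1 fun hs => hTT' (Finset.eq_of_subset_of_card_le hs hc.ge)
    obtain ⟨l, hl, hl'⟩ := Finset.not_subset.1
      fun hs => hTT' (Finset.eq_of_subset_of_card_le hs hc.le).symm
    have h1 := mem_upperEvent.1 hx l j hl' hj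
    have h2 := mem_upperEvent.1 hx' j l hj' hl
    linarith
  calc _ ≤ ∑ T ∈ F, Measure.pi (fun _ : Fin (n + 2) => ν) (upperEvent T b) :=
        (measure_mono hsub).trans (measure_biUnion_finset_le _ _)
    _ ≤ ∑ T ∈ F, h * Measure.pi (fun _ : Fin (n + 2) => ν) (upperEvent T fun _ => 0) :=
        Finset.sum_le_sum fun T hT => pi_upperEvent_le ν hb hb0 H (hne T hT).1 (hne T hT).2
    _ = h * Measure.pi (fun _ : Fin (n + 2) => ν) (⋃ T ∈ F, upperEvent T fun _ => 0) := by
        rw [← Finset.mul_sum, measure_biUnion_finset hdisj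
          fun T _ => measurableSet_upperEvent T measurable_const]
    _ ≤ h := mul_le_of_le_one_right zero_le prob_le_one

/-! ### Sub-Gaussian lower tails -/

/-- A nonnegative random variable has a sub-Gaussian lower tail, with a constant that depends only
on a bound on its second moment. -/
theorem SubGaussianLowerTail.of_second_moment {Ω : Type*} [MeasurableSpace Ω] {μ : Measure Ω}
    [IsProbabilityMeasure μ] {X : Ω → ℝ} (hX : MemLp X 2 μ) (hX0 : ∀ ω, 0 ≤ X ω) {V : ℝ}
    (hV : 0 < V) (hXV : ∫ ω, X ω ^ 2 ∂μ ≤ V) : SubGaussianLowerTail X μ (1 / (2 * V)) := by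
  intro t ht
  set e := ∫ ω, X ω ∂μ
  have hint : Integrable X μ := hX.integrable one_le_two
  have hsq : Integrable (fun ω => X ω ^ 2) μ := hX.integrable_sq
  have hshift : ∀ c : ℝ, ∫ ω, (c - X ω) ^ 2 ∂μ = c ^ 2 - 2 * c * e + ∫ ω, X ω ^ 2 ∂μ := by
    intro c
    have : (fun ω => (c - X ω) ^ 2) = fun ω => c ^ 2 - 2 * c * X ω + X ω ^ 2 := by
      ext ω; ring
    rw [this, integral_add (f := fun ω => c ^ 2 - 2 * c * X ω)
        ((integrable_const _).sub (hint.const_mul _)) hsq,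
      integral_sub (integrable_const _) (hint.const_mul _), integral_const_mul]
    simp [e]
  have heV : e ^ 2 ≤ V := by
    have h0 : 0 ≤ ∫ ω, (e - X ω) ^ 2 ∂μ := integral_nonneg fun _ => sq_nonneg _
    rw [hshift] at h0
    nlinarith
  rcases lt_or_ge V (t ^ 2) with htV | htV
  -- Here the mean is below `t`, so nonnegativity makes the event empty.
  · have het : e < t := lt_of_pow_lt_pow_left₀ 2 ht.le (heV.trans_lt htV)
    have : {ω | X ω - e < -t} = ∅ := by
      ext ω
      simp only [Set.mem_ofPred_eq, Set.mem_empty_iff_false, iff_false, not_lt]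
      linarith [hX0 ω]
    rw [this, measureReal_empty]
    positivity
  -- Cantelli's inequality: the shift `V / t` gives the bound `V / (V + t ^ 2)`. With `r = t ^ 2 / V
  -- ≤ 1`, it is at most `exp (-r / 2)` because `exp (r / 2) ≤ 1 + r`.
  · set c := e + V / t
    have hp : 0 < t + V / t := by positivity
    have hsub : {ω | X ω - e < -t} ⊆ {ω | (t + V / t) ^ 2 ≤ (c - X ω) ^ 2} := by
      intro ω hω
      simp only [Set.mem_ofPred_eq] at hω ⊢
      gcongr
      simp only [c]
      linarith
    have hci : Integrable (fun ω => (c - X ω) ^ 2) μ :=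
      ((memLp_const c).sub hX).integrable_sq
    have hM := mul_meas_ge_le_integral_of_nonneg (μ := μ) (f := fun ω => (c - X ω) ^ 2)
      (.of_forall fun _ => sq_nonneg _) hci ((t + V / t) ^ 2)
    have hE : ∫ ω, (c - X ω) ^ 2 ∂μ ≤ V + (V / t) ^ 2 := by
      rw [hshift]
      simp only [c]
      nlinarith [sq_nonneg e]
    have h1 : μ.real {ω | X ω - e < -t} ≤ V / (V + t ^ 2) := by
      have h2 : (t + V / t) ^ 2 * μ.real {ω | X ω - e < -t} ≤ V + (V / t) ^ 2 :=
        (mul_le_mul_of_nonneg_left (measureReal_mono hsub) (by positivity)).trans (hM.trans hE)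
      have h3 : V / (V + t ^ 2) = (V + (V / t) ^ 2) / (t + V / t) ^ 2 := by
        field_simp
        ring
      rw [h3, le_div_iff₀ (by positivity), mul_comm]
      exact h2
    refine h1.trans ?_
    set r := t ^ 2 / V with hr
    have hr0 : 0 ≤ r := by positivity
    have hr1 : r ≤ 1 := (div_le_one hV).2 htV
    have h4 : Real.exp (r / 2) ≤ 1 + r := by
      have := (abs_le.1 (Real.abs_exp_sub_one_le (x := r / 2)
        (by rw [abs_of_nonneg (by positivity)]; linarith))).2
      rw [abs_of_nonneg (by positivity)] at this
      linarith
    have h5 : V / (V + t ^ 2) = (1 + r)⁻¹ := by rw [hr]; field_simp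
    have h6 : -(1 / (2 * V)) * t ^ 2 = -(r / 2) := by rw [hr]; field_simp
    rw [h5, h6, Real.exp_neg]
    gcongr

/-- A sub-Gaussian lower tail also bounds the probability of the closed tail event. -/
theorem SubGaussianLowerTail.measureReal_le {Ω : Type*} [MeasurableSpace Ω] {μ : Measure Ω}
    [IsProbabilityMeasure μ] {X : Ω → ℝ} {c : ℝ} (h : SubGaussianLowerTail X μ c) {t : ℝ}
    (ht : 0 < t) : μ.real {ω | X ω ≤ ∫ ω', X ω' ∂μ - t} ≤ Real.exp (-c * t ^ 2) := by
  have hc : ContinuousWithinAt (fun s => Real.exp (-c * s ^ 2)) (Set.Iio t) t := by fun_prop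
  refine ge_of_tendsto hc ?_
  filter_upwards [Ioo_mem_nhdsLT ht] with s hs
  refine (measureReal_mono fun ω hω => ?_).trans (h s hs.1)
  simp only [Set.mem_ofPred_eq] at hω ⊢
  linarith [hs.2]

/-! ### Distortion and preservation of neighbours -/

theorem dist_ordered_mono {N Q : ℕ} (x : Fin (Q + 1) → Point N) {i j : Fin (Q + 1)}
    (hi : 1 ≤ (i : ℕ)) (hij : i ≤ j) :
    dist (ordered x 0) (ordered x i) ≤ dist (ordered x 0) (ordered x j) := by
  have hi0 : i ≠ 0 := by rintro rfl; simp at hi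
  have hj0 : j ≠ 0 := fun e => hi0 (by simpa [e] using hij)
  obtain ⟨i, rfl⟩ := Fin.exists_succ_eq.2 hi0
  obtain ⟨j, rfl⟩ := Fin.exists_succ_eq.2 hj0
  exact Tuple.monotone_sort (fun i : Fin Q => dist (x 0) (x i.succ)) (Fin.succ_le_succ_iff.1 hij)

/-- A hashing that fails to preserve the nearest neighbours has a distortion of at least half the
gap. -/
theorem orderGap_le_of_not_preservesNeighbors {N Q M : ℕ} {k : Fin Q}
    {f : Point N → Code M} {x : Fin (Q + 1) → Point N} (h : ¬ PreservesNeighbors k f x) :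
    orderGap k x ≤ 2 * distortion f x := by
  simp only [PreservesNeighbors, not_forall, not_le] at h
  obtain ⟨i, j, hi, hik, hkj, hij⟩ := h
  have hgap : orderGap k x ≤
      dist (ordered x 0) (ordered x j) - dist (ordered x 0) (ordered x i) :=
    sub_le_sub (dist_ordered_mono x (by simp) (by simpa [Fin.le_def] using hkj))
      (dist_ordered_mono x hi (by simpa [Fin.le_def] using hik))
  suffices orderGap k x / 2 ≤ distortion f x by linarith
  have : Nonempty (Set.Ioi (0 : ℝ)) := ⟨⟨1, Set.mem_Ioi.2 one_pos⟩⟩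
  refine le_ciInf fun lam => ?_
  set s := ⨆ ij : {ij : Fin (Q + 1) × Fin (Q + 1) // ij.2 < ij.1},
    |(lam : ℝ) * (hammingDist (f (x ij.1.1)) (f (x ij.1.2)) : ℝ) - dist (x ij.1.1) (x ij.1.2)|
  have hs : ∀ i : Fin (Q + 1), 1 ≤ (i : ℕ) →
      |(lam : ℝ) * (hammingDist (f (ordered x 0)) (f (ordered x i)) : ℝ) -
        dist (ordered x 0) (ordered x i)| ≤ s := by
    intro i hi
    obtain ⟨i, rfl⟩ := Fin.exists_succ_eq.2 (show i ≠ 0 by rintro rfl; simp at hi)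
    rw [hammingDist_comm, dist_comm]
    exact le_ciSup (f := fun ij : {ij : Fin (Q + 1) × Fin (Q + 1) // ij.2 < ij.1} =>
      |(lam : ℝ) * (hammingDist (f (x ij.1.1)) (f (x ij.1.2)) : ℝ) - dist (x ij.1.1) (x ij.1.2)|)
      (Set.finite_range _).bddAbove ⟨(_, 0), Fin.succ_pos _⟩
  have h1 := abs_le.1 (hs i hi)
  have h2 := abs_le.1 (hs j (by omega))
  -- The scaled code distances are in the wrong order, so the errors at `i` and `j` together cover
  -- the gap.
  have h3 : (lam : ℝ) * (hammingDist (f (ordered x 0)) (f (ordered x j)) : ℝ) ≤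
      lam * hammingDist (f (ordered x 0)) (f (ordered x i)) :=
    mul_le_mul_of_nonneg_left (by exact_mod_cast hij.le) (le_of_lt lam.2)
  linarith [h1.1, h2.2]

/-- With high probability, a distortion that is small relative to the expected gap forces the
nearest neighbours to be preserved. -/
theorem one_sub_le_measureReal_preservesNeighbors {Ω : Type*} [MeasurableSpace Ω] {μ : Measure Ω}
    [IsProbabilityMeasure μ] {N Q M : ℕ} {k : Fin Q} (hk : 1 ≤ (k : ℕ))
    {x : Fin (Q + 1) → Ω → Point N}
    (hX : AEMeasurable (fun ω => orderGap k (fun i => x i ω)) μ) {c : ℝ} (hc : 0 < c)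
    (h : SubGaussianLowerTail (fun ω => orderGap k (fun i => x i ω)) μ c)
    (f : Ω → Point N → Code M) {ε : ℝ} (hε : 0 < ε) :
    1 - ε ≤ μ.real {ω |
      2 * distortion (f ω) (fun i => x i ω)
          + Real.sqrt (1 / c * Real.log ((Q : ℝ) * (k : ℕ) / ε))
        ≤ ∫ ω', orderGap k (fun i => x i ω') ∂μ →
      PreservesNeighbors k (f ω) (fun i => x i ω)} := by
  rcases le_or_gt 1 ε with h1 | h1
  · exact (sub_nonpos.2 h1).trans measureReal_nonneg
  have hQk : (1 : ℝ) ≤ Q * (k : ℕ) := by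
    exact_mod_cast Nat.mul_pos (Nat.zero_lt_of_lt k.2) hk
  have harg : 1 < (Q : ℝ) * (k : ℕ) / ε := by
    rw [lt_div_iff₀ hε]; linarith
  set t := Real.sqrt (1 / c * Real.log ((Q : ℝ) * (k : ℕ) / ε))
  have hlog := Real.log_pos harg
  have ht : 0 < t := Real.sqrt_pos.2 (by positivity)
  set X := fun ω => orderGap k (fun i => x i ω)
  have hB : μ.real {ω | X ω ≤ ∫ ω', X ω' ∂μ - t} ≤ ε := by
    refine (h.measureReal_le ht).trans ?_
    rw [Real.sq_sqrt (by positivity)]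
    have : -c * (1 / c * Real.log ((Q : ℝ) * (k : ℕ) / ε)) =
        -Real.log ((Q : ℝ) * (k : ℕ) / ε) := by field_simp
    rw [this, Real.exp_neg, Real.exp_log (by linarith), inv_div]
    -- The tail is `ε / (Q * k)`; no union bound is taken, so the factor `Q * k ≥ 1` is pure slack.
    exact div_le_self hε.le hQk
  have hBm : NullMeasurableSet {ω | X ω ≤ ∫ ω', X ω' ∂μ - t} μ :=
    nullMeasurableSet_le hX aemeasurable_const
  calc 1 - ε ≤ 1 - μ.real {ω | X ω ≤ ∫ ω', X ω' ∂μ - t} := by linarith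
    _ = μ.real {ω | X ω ≤ ∫ ω', X ω' ∂μ - t}ᶜ := by
        rw [measureReal_compl₀ hBm, probReal_univ]
    _ ≤ _ := by
        -- Monotonicity holds for arbitrary sets, so measurability of the implication event is not
        -- needed.
        refine measureReal_mono fun ω hω hle => ?_
        by_contra hP
        refine hω ?_
        have := orderGap_le_of_not_preservesNeighbors hP
        simp only [Set.mem_ofPred_eq, X] at this ⊢
        linarith

/-! ### Uniform second moments for mixtures -/

theorem isProbabilityMeasure_gaussianMixture {N P : ℕ} {w : Fin P → NNReal} (hw : ∑ p, w p = 1)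
    (m : Fin P → Point N) (S : Fin P → Matrix (Fin N) (Fin N) ℝ) :
    IsProbabilityMeasure (gaussianMixture w m S) where
  measure_univ := by
    simp only [gaussianMixture, Measure.coe_finsetSum, Finset.sum_apply, Measure.smul_apply,
      measure_univ, ENNReal.smul_def, smul_eq_mul, mul_one]
    exact_mod_cast hw

theorem lintegral_norm_sq_gaussianMixture_lt_top {N P : ℕ} (w : Fin P → NNReal)
    (m : Fin P → Point N) (S : Fin P → Matrix (Fin N) (Fin N) ℝ) (K : ℝ) :
    ∫⁻ y, ENNReal.ofReal ((4 * (‖y‖ + K)) ^ 2) ∂gaussianMixture w m S < ⊤ := by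
  simp only [gaussianMixture]
  rw [lintegral_finsetSum_measure]
  refine ENNReal.sum_lt_top.2 fun p _ => ?_
  rw [lintegral_smul_measure, ENNReal.smul_def, smul_eq_mul]
  refine ENNReal.mul_lt_top ENNReal.coe_lt_top ?_
  have h : MemLp (fun y : Point N => 4 * (‖y‖ + K)) 2 (multivariateGaussian (m p) (S p)) :=
    ((IsGaussian.memLp_two_id (μ := multivariateGaussian (m p) (S p))).norm.add
      (memLp_const K)).const_mul 4
  exact h.integrable_sq.lintegral_lt_top

/-- The second moments of all order gaps of a Gaussian mixture are bounded by one constant. -/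
theorem exists_lintegral_orderGap_sq_le {N P : ℕ} {w : Fin P → NNReal} (hw : ∑ p, w p = 1)
    (m : Fin P → Point N) (S : Fin P → Matrix (Fin N) (Fin N) ℝ) :
    ∃ V : ℝ, 0 < V ∧ ∀ (n : ℕ) (k : Fin n),
      ∫⁻ x : Fin (n + 2) → Point N, ENNReal.ofReal (orderGap k.succ x ^ 2)
        ∂Measure.pi (fun _ => gaussianMixture w m S) ≤ ENNReal.ofReal V := by
  have := isProbabilityMeasure_gaussianMixture hw m S
  obtain ⟨K, L, hL, hK, htail⟩ := gaussianMixture_tail w m S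
  set ν := gaussianMixture w m S
  set b : Point N → ℝ := fun y => 4 * (‖y‖ + K) with hb
  have hbm : Measurable b := by fun_prop
  have hb0 : ∀ y, 0 ≤ b y := fun y => by positivity
  set I := ∫⁻ y, ENNReal.ofReal (b y ^ 2) ∂ν with hI
  set J := ∫⁻ t in Set.Ioi (0 : ℝ), ENNReal.ofReal (2 ^ N * Real.exp (-L * t ^ 2)) *
    ENNReal.ofReal (t ^ ((2 : ℝ) - 1)) with hJ
  have hI' : I < ⊤ := lintegral_norm_sq_gaussianMixture_lt_top w m S K
  have hJ' : J < ⊤ := by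
    have hint : Integrable fun t : ℝ => 2 ^ N * (t * Real.exp (-L * t ^ 2)) :=
      (integrable_mul_exp_neg_mul_sq hL).const_mul _
    refine (lintegral_mono_ae ?_).trans_lt hint.integrableOn.lintegral_lt_top
    filter_upwards [ae_restrict_mem measurableSet_Ioi] with t _
    rw [← ENNReal.ofReal_mul (by positivity)]
    refine ENNReal.ofReal_le_ofReal (le_of_eq ?_)
    norm_num
    ring
  set C := 2 * (ENNReal.ofReal 2 * J) + 2 * I
  have hC : C < ⊤ := by
    refine ENNReal.add_lt_top.2 ⟨ENNReal.mul_lt_top (by simp) (ENNReal.mul_lt_top (by simp) hJ'),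
      ENNReal.mul_lt_top (by simp) hI'⟩
  refine ⟨C.toReal + 1, by positivity, fun n k => ?_⟩
  have hCV : C ≤ ENNReal.ofReal (C.toReal + 1) := by
    rw [← ENNReal.ofReal_toReal hC.ne]
    exact ENNReal.ofReal_le_ofReal (by simp)
  refine le_trans ?_ hCV
  set π := Measure.pi fun _ : Fin (n + 2) => ν
  -- `D` is the excess of the gap over the random margin `b (x 0)`. The layer-cake formula and the
  -- tail bound with margin `t + b` control its second moment by `2 * J`; the margin contributes
  -- `I`.
  set D : (Fin (n + 2) → Point N) → ℝ := fun x => max (orderGap k.succ x - b (x 0)) 0 with hD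
  have hDm : Measurable D :=
    ((measurable_orderGap k).sub (hbm.comp (measurable_pi_apply 0))).max measurable_const
  have hD0 : ∀ x, 0 ≤ D x := fun x => le_max_right _ _
  have hDJ : ∫⁻ x, ENNReal.ofReal (D x ^ 2) ∂π ≤ ENNReal.ofReal 2 * J := by
    have := lintegral_rpow_eq_lintegral_meas_lt_mul π (.of_forall hD0) hDm.aemeasurable two_pos
    simp only [Real.rpow_two] at this
    rw [this, hJ]
    gcongr ENNReal.ofReal 2 * ?_
    refine setLIntegral_mono_ae' measurableSet_Ioi (.of_forall fun t ht => ?_)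
    gcongr
    have ht0 : 0 < t := ht
    refine le_trans (measure_mono fun x hx => ?_)
      (pi_lt_orderGap_le ν (b := fun y => t + b y) (by fun_prop) (fun y => by have := hb0 y; positivity)
        (fun y a ha => htail y a t ha ht0) k)
    have hx : t < D x := hx
    have := (lt_max_iff.1 hx).resolve_right (not_lt.2 ht0.le)
    simp only [Set.mem_ofPred_eq]
    linarith
  have hbI : ∫⁻ x, ENNReal.ofReal (b (x 0) ^ 2) ∂π = I :=
    (measurePreserving_eval (fun _ : Fin (n + 2) => ν) 0).lintegral_comp
      (f := fun y => ENNReal.ofReal (b y ^ 2)) (by fun_prop)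
  calc _ ≤ ∫⁻ x, (2 * ENNReal.ofReal (D x ^ 2) + 2 * ENNReal.ofReal (b (x 0) ^ 2)) ∂π := by
        refine lintegral_mono fun x => ?_
        have h2 : (2 : ENNReal) = ENNReal.ofReal 2 := by simp
        rw [h2, ← ENNReal.ofReal_mul two_pos.le, ← ENNReal.ofReal_mul two_pos.le,
          ← ENNReal.ofReal_add (by positivity) (by positivity)]
        refine ENNReal.ofReal_le_ofReal ?_
        have h3 : orderGap k.succ x ≤ D x + b (x 0) := by
          linarith [le_max_left (orderGap k.succ x - b (x 0)) 0]
        have h4 := pow_le_pow_left₀ (orderGap_nonneg k x) h3 2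
        linarith [add_sq_le (a := D x) (b := b (x 0))]
    _ = 2 * ∫⁻ x, ENNReal.ofReal (D x ^ 2) ∂π + 2 * I := by
        rw [lintegral_add_left (by fun_prop), lintegral_const_mul _ (by fun_prop),
          lintegral_const_mul _ (by fun_prop), hbI]
    _ ≤ C := by
        simp only [C]
        gcongr

end BinaryHashing

end

theorem mainTheorem1 (N P : ℕ) (w : Fin P → NNReal) (hw : ∑ p, w p = 1)
    (m : Fin P → BinaryHashing.Point N) (S : Fin P → Matrix (Fin N) (Fin N) ℝ)
    (hS : ∀ p, (S p).PosSemidef) :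
    -- a constant that depends on the mixture only
    ∃ c₀ : ℝ, 0 < c₀ ∧
      ∀ (Q : ℕ) (k : Fin Q), 1 ≤ (k : ℕ) →
      ∀ (Ω : Type u) [MeasurableSpace Ω] (μ : Measure Ω) [IsProbabilityMeasure μ]
        (x : Fin (Q + 1) → Ω → BinaryHashing.Point N),
        iIndepFun x μ →
        (∀ i, HasLaw (x i) (BinaryHashing.gaussianMixture w m S) μ) →
        -- the gap has an expectation, and the lower-tail bound holds with `c₀`
        Integrable (fun ω => BinaryHashing.orderGap k (fun i => x i ω)) μ ∧
        BinaryHashing.SubGaussianLowerTail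
          (fun ω => BinaryHashing.orderGap k (fun i => x i ω)) μ c₀ ∧
        -- neighbour preservation, for `c₀` and for every other constant of the lower-tail bound
        ∀ c : ℝ, 0 < c →
          BinaryHashing.SubGaussianLowerTail
            (fun ω => BinaryHashing.orderGap k (fun i => x i ω)) μ c →
          ∀ (M : ℕ) (f : Ω → BinaryHashing.Point N → BinaryHashing.Code M),
            (∀ i, AEMeasurable (fun ω => f ω (x i ω)) μ) →
            ∀ ε : ℝ, 0 < ε →
              1 - ε ≤ μ.real {ω |
                2 * BinaryHashing.distortion (f ω) (fun i => x i ω)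
                    + Real.sqrt (1 / c * Real.log ((Q : ℝ) * (k : ℕ) / ε))
                  ≤ ∫ ω', BinaryHashing.orderGap k (fun i => x i ω') ∂μ →
                BinaryHashing.PreservesNeighbors k (f ω) (fun i => x i ω)} ∧
              ((∀ᵐ ω ∂μ,
                2 * BinaryHashing.distortion (f ω) (fun i => x i ω)
                    + Real.sqrt (1 / c * Real.log ((Q : ℝ) * (k : ℕ) / ε))
                  ≤ ∫ ω', BinaryHashing.orderGap k (fun i => x i ω') ∂μ) →
                1 - ε ≤ μ.real {ω |
                  BinaryHashing.PreservesNeighbors k (f ω) (fun i => x i ω)}) := by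
  obtain ⟨V, hV, hVle⟩ := BinaryHashing.exists_lintegral_orderGap_sq_le hw m S
  have := BinaryHashing.isProbabilityMeasure_gaussianMixture hw m S
  refine ⟨1 / (2 * V), by positivity, fun Q k hk Ω _ μ _ x hind hlaw => ?_⟩
  have hpi := hind.hasLaw_pi hlaw
  obtain ⟨hm, h0, hle⟩ : (Measurable fun y : Fin (Q + 1) → BinaryHashing.Point N =>
      BinaryHashing.orderGap k y) ∧
      (∀ y : Fin (Q + 1) → BinaryHashing.Point N, 0 ≤ BinaryHashing.orderGap k y) ∧
      ∫⁻ y, ENNReal.ofReal (BinaryHashing.orderGap k y ^ 2)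
        ∂Measure.pi (fun _ : Fin (Q + 1) => BinaryHashing.gaussianMixture w m S) ≤
          ENNReal.ofReal V := by
    -- As `1 ≤ k < Q`, the data have the form `Q = n + 1` and `k = k'.succ` used in the gap lemmas.
    obtain ⟨n, rfl⟩ : ∃ n, Q = n + 1 := ⟨Q - 1, by omega⟩
    obtain ⟨k, rfl⟩ := Fin.exists_succ_eq.2 (show k ≠ 0 by rintro rfl; simp at hk)
    exact ⟨BinaryHashing.measurable_orderGap k, BinaryHashing.orderGap_nonneg k, hVle n k⟩
  have hX : AEMeasurable (fun ω => BinaryHashing.orderGap k (fun i => x i ω)) μ :=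
    hm.comp_aemeasurable hpi.aemeasurable
  have hXV : ∫⁻ ω, ENNReal.ofReal (BinaryHashing.orderGap k (fun i => x i ω) ^ 2) ∂μ ≤
      ENNReal.ofReal V := by
    rwa [← hpi.map_eq, lintegral_map' (by fun_prop) hpi.aemeasurable] at hle
  have hsq : Integrable (fun ω => BinaryHashing.orderGap k (fun i => x i ω) ^ 2) μ :=
    ⟨(hX.pow_const 2).aestronglyMeasurable,
      (hasFiniteIntegral_iff_ofReal (.of_forall fun _ => sq_nonneg _)).2
        (hXV.trans_lt ENNReal.ofReal_lt_top)⟩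
  have hL2 : MemLp (fun ω => BinaryHashing.orderGap k (fun i => x i ω)) 2 μ :=
    (memLp_two_iff_integrable_sq hX.aestronglyMeasurable).2 hsq
  have hE : ∫ ω, BinaryHashing.orderGap k (fun i => x i ω) ^ 2 ∂μ ≤ V := by
    rw [← ENNReal.ofReal_le_ofReal_iff hV.le,
      ofReal_integral_eq_lintegral_ofReal hsq (.of_forall fun _ => sq_nonneg _)]
    exact hXV
  refine ⟨hL2.integrable one_le_two,
    BinaryHashing.SubGaussianLowerTail.of_second_moment hL2 (fun ω => h0 _) hV hE,
    fun c hc hct M f _ ε hε => ?_⟩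
  have hmain := BinaryHashing.one_sub_le_measureReal_preservesNeighbors hk hX hc hct f hε
  refine ⟨hmain, fun hae => hmain.trans (ENNReal.toReal_mono (measure_ne_top _ _)
    (measure_mono_ae ?_))⟩
  filter_upwards [hae] with ω hω himp using himp hω
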